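/- Let $r,n$ be natural numbers and let $$H=\{h=\mathrm{diag}(h_1,\dots,h_n) : h_i\in GL(r,\mathbb C)\}\subset GL(rn,\mathbb C),\qquad H\simeq GL(r,\mathbb C)^n,$$ be the complex Lie group of invertible block diagonal matrices. Let $p:\tilde H\to H$ be the universal covering group of $H$ (a simply connected topological group $\tilde H$ with a surjective homomorphism $p$ that is a covering map), with the complex structure for which $p$ is locally biholomorphic. For $h\in\tilde H$ write $p(h)=\mathrm{diag}(h_1,\dots,h_n)$. There are unique continuous functions $\log\det h_i:\tilde H\to\mathbb C$ $(1\le i\le n)$ that vanish at the identity and satisfy $\exp(\log\det h_i)=\det h_i$. For $\beta\in\mathbb C$ put $(\det h_i)^{\beta}=\exp(\beta\log\det h_i)$, a function on $\tilde H$. Then for every character $\chi$ of $\tilde H$, that is, every holomorphic group homomorphism $\chi:\tilde H\to\mathbb C^\times$, there is $\alpha=(\alpha_1,\dots,\alpha_n)\in\mathbb C^n$ such that $$\chi(h)=\prod_{i=1}^n(\det h_i)^{\alpha_i}\qquad\text{for all }h\in\tilde H.$$ -/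

import Mathlib

open scoped Topology

/-- The embedding `(h₁, …, hₙ) ↦ diag(h₁, …, hₙ)` of `GL(r, ℂ)ⁿ` in `GL(rn, ℂ)`. The `rn` rows and
columns are labelled by pairs: `(a, i)` is the `a`-th row (column) of the `i`-th block. -/
def blockDiagonalHom (r n : ℕ) :
    (Fin n → GL (Fin r) ℂ) →* GL (Fin r × Fin n) ℂ :=
  (Units.map ((Matrix.blockDiagonalRingHom (Fin r) (Fin n) ℂ :
      (Fin n → Matrix (Fin r) (Fin r) ℂ) →+* Matrix (Fin r × Fin n) (Fin r × Fin n) ℂ) :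
      (Fin n → Matrix (Fin r) (Fin r) ℂ) →* Matrix (Fin r × Fin n) (Fin r × Fin n) ℂ)).comp
    (MulEquiv.piUnits (M := fun _ : Fin n => Matrix (Fin r) (Fin r) ℂ)).symm.toMonoidHom

/-- The group `H` of invertible block diagonal matrices `diag(h₁, …, hₙ)`, `hᵢ ∈ GL(r, ℂ)`, as a
(topological) subgroup of `GL(rn, ℂ)`. -/
def blockDiagonalGL (r n : ℕ) : Subgroup (GL (Fin r × Fin n) ℂ) :=
  (blockDiagonalHom r n).range

/-- The `i`-th diagonal block `hᵢ` of `h = diag(h₁, …, hₙ) ∈ H`. -/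
def diagBlock {r n : ℕ} (h : blockDiagonalGL r n) (i : Fin n) : Matrix (Fin r) (Fin r) ℂ :=
  Matrix.blockDiag ((h : GL (Fin r × Fin n) ℂ) : Matrix (Fin r × Fin n) (Fin r × Fin n) ℂ) i

/-- The entries of the blocks: the global holomorphic coordinates of the complex Lie group `H`,
which identify it with an open subset of `ℂ^(n r²)`. -/
def blockCoords {r n : ℕ} (h : blockDiagonalGL r n) : Fin n → Fin r → Fin r → ℂ :=
  fun i a b => diagBlock h i a b

/-- `p : H' → H` exhibits the topological group `H'` as the universal covering group of the
topological group `H`: it is a surjective group homomorphism and a covering map, and `H'` is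
simply connected (in particular path connected). -/
structure IsUniversalCoveringGroup {H H' : Type*} [Group H] [TopologicalSpace H]
    [Group H'] [TopologicalSpace H'] (p : H' →* H) : Prop where
  isTopologicalGroup : IsTopologicalGroup H'
  simplyConnected : SimplyConnectedSpace H'
  isCoveringMap : IsCoveringMap p
  surjective : Function.Surjective p

/-- Holomorphic functions on a covering `p : H' → H` of `H`, for the unique complex structure on
`H'` that makes `p` locally biholomorphic: near every point, `f` is a complex analytic function of
the coordinates of `p y`. -/
def IsHolomorphicOnCover {r n : ℕ} {H' : Type*} [TopologicalSpace H']
    (p : H' → blockDiagonalGL r n) (f : H' → ℂ) : Prop :=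
  ∀ x : H', ∃ F : (Fin n → Fin r → Fin r → ℂ) → ℂ,
    AnalyticAt ℂ F (blockCoords (p x)) ∧ ∀ᶠ y in 𝓝 x, f y = F (blockCoords (p y))

/-- The branches of `log det hᵢ` (`i = 1, …, n`) on a covering group `p : H' → H` that are continuous
on all of `H'` and vanish at the identity. With them, `(det hᵢ) ^ β` is the function
`exp (β * L i h)` on `H'`. -/
structure IsLogDet {r n : ℕ} {H' : Type*} [Group H'] [TopologicalSpace H']
    (p : H' →* blockDiagonalGL r n) (L : Fin n → H' → ℂ) : Prop where
  continuous : ∀ i, Continuous (L i)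
  map_one : ∀ i, L i 1 = 0
  exp_eq : ∀ i h, Complex.exp (L i h) = (diagBlock (p h) i).det

open Filter Function

/-! ### Block diagonal matrices in coordinates -/

section Coordinates

variable {r n : ℕ}

/-! A character is determined by its derivative `Λ` at the identity, a linear form on `n`-tuples of
matrices. Since the target is commutative, `χ (x * y * x⁻¹) = χ y`, so `Λ` is invariant under
conjugation and hence a combination `∑ αᵢ tr Xᵢ` of block traces
(`exists_eq_sum_blockTrace_of_conj_invariant`). The trace is also the derivative of `log det` at
`1`, so `ψ = χ * exp (-∑ αᵢ log det hᵢ)` is multiplicative with zero derivative at `1`. By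
translation its derivative vanishes near `1`, so its kernel is an open subgroup, which is everything
because the cover is connected (`eq_one_of_hasFDerivAt_zero`). Simple connectedness is what provides
the functions `log det hᵢ`. -/

theorem diagBlock_blockDiagonalHom (A : Fin n → GL (Fin r) ℂ)
    (i : Fin n) : diagBlock ⟨blockDiagonalHom r n A, A, rfl⟩ i = A i :=
  congrFun (Matrix.blockDiag_blockDiagonal fun i => (A i : Matrix (Fin r) (Fin r) ℂ)) i

theorem blockDiagonal_diagBlock (h : blockDiagonalGL r n) :
    Matrix.blockDiagonal (diagBlock h) =
      ((h : GL (Fin r × Fin n) ℂ) : Matrix (Fin r × Fin n) (Fin r × Fin n) ℂ) := by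
  obtain ⟨_, A, rfl⟩ := h
  exact congrArg Matrix.blockDiagonal (funext (diagBlock_blockDiagonalHom A))

theorem diagBlock_mul (g h : blockDiagonalGL r n) (i : Fin n) :
    diagBlock (g * h) i = diagBlock g i * diagBlock h i := by
  have : diagBlock (g * h) = fun i => diagBlock g i * diagBlock h i := by
    apply Matrix.blockDiagonal_injective
    rw [Matrix.blockDiagonal_mul, blockDiagonal_diagBlock, blockDiagonal_diagBlock,
      blockDiagonal_diagBlock]
    rfl
  exact congrFun this i

theorem diagBlock_one (i : Fin n) : diagBlock (1 : blockDiagonalGL r n) i = 1 :=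
  congrFun Matrix.blockDiag_one i

theorem det_diagBlock_ne_zero (h : blockDiagonalGL r n) (i : Fin n) :
    (diagBlock h i).det ≠ 0 := by
  have hmul : (diagBlock h i).det * (diagBlock h⁻¹ i).det = 1 := by
    rw [← Matrix.det_mul, ← diagBlock_mul, mul_inv_cancel, diagBlock_one, Matrix.det_one]
  exact left_ne_zero_of_mul_eq_one hmul

theorem exists_diagBlock_eq (A : Fin n → GL (Fin r) ℂ) :
    ∃ h : blockDiagonalGL r n, ∀ i, diagBlock h i = A i :=
  ⟨⟨_, A, rfl⟩, diagBlock_blockDiagonalHom A⟩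

theorem Matrix.GeneralLinearGroup.isEmbedding_val {m : Type*} [Fintype m] [DecidableEq m] :
    Topology.IsEmbedding (Units.val : GL m ℂ → Matrix m m ℂ) := by
  let _ := Matrix.linftyOpNormedRing (n := m) (α := ℂ)
  let _ := Matrix.linftyOpNormedAlgebra (n := m) (α := ℂ) (R := ℂ)
  have : CompleteSpace (Matrix m m ℂ) := FiniteDimensional.complete ℂ _
  exact Units.isOpenEmbedding_val.isEmbedding

theorem continuous_diagBlock (i : Fin n) :
    Continuous fun h : blockDiagonalGL r n => diagBlock h i := by
  unfold diagBlock
  have : Continuous fun h : blockDiagonalGL r n =>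
      ((h : GL (Fin r × Fin n) ℂ) : Matrix (Fin r × Fin n) (Fin r × Fin n) ℂ) :=
    Units.continuous_val.comp continuous_subtype_val
  exact (continuous_apply i).comp this.matrix_blockDiag

theorem continuous_blockCoords : Continuous (blockCoords : blockDiagonalGL r n → _) :=
  continuous_pi fun i => continuous_pi fun a => continuous_pi fun b =>
    (continuous_diagBlock i).matrix_elem a b

theorem range_blockCoords :
    Set.range (blockCoords : blockDiagonalGL r n → _) =
      {M | ∀ i, (Matrix.of (M i)).det ≠ 0} := by
  ext M
  constructor
  · rintro ⟨h, rfl⟩ i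
    exact det_diagBlock_ne_zero h i
  · intro hM
    obtain ⟨h, hh⟩ := exists_diagBlock_eq fun i =>
      Matrix.GeneralLinearGroup.mkOfDetNeZero (Matrix.of (M i)) (hM i)
    exact ⟨h, funext hh⟩

theorem continuous_det_of (i : Fin n) :
    Continuous fun M : Fin n → Fin r → Fin r → ℂ => (Matrix.of (M i)).det :=
  (Continuous.matrix_det continuous_id).comp (continuous_apply i)

/-- Reassembling the blocks continuously recovers the inclusion into matrices, itself an embedding;
the range is cut out by finitely many open conditions `det ≠ 0`. -/
theorem isOpenEmbedding_blockCoords :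
    Topology.IsOpenEmbedding (blockCoords : blockDiagonalGL r n → _) := by
  have hcont : Continuous fun M : Fin n → Fin r → Fin r → ℂ =>
      Matrix.blockDiagonal fun i => Matrix.of (M i) :=
    Continuous.matrix_blockDiagonal (continuous_pi fun i => continuous_apply i)
  refine ⟨Topology.IsEmbedding.of_comp continuous_blockCoords hcont ?_, ?_⟩
  · convert Matrix.GeneralLinearGroup.isEmbedding_val.comp Topology.IsEmbedding.subtypeVal using 1
    ext1 h
    exact blockDiagonal_diagBlock h
  · rw [range_blockCoords, Set.ofPred_forall]
    exact isOpen_iInter_of_finite fun i => isOpen_ne_fun (continuous_det_of i) continuous_const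

/-- The linear map `(Xᵢ) ↦ (Aᵢ Xᵢ Bᵢ)` in the coordinates of the block diagonal matrices. -/
noncomputable def blockMulLeftRight (A B : Fin n → Matrix (Fin r) (Fin r) ℂ) :
    (Fin n → Fin r → Fin r → ℂ) →L[ℂ] (Fin n → Fin r → Fin r → ℂ) :=
  LinearMap.toContinuousLinearMap
    { toFun := fun X i => A i * Matrix.of (X i) * B i
      map_add' := fun X Y => funext fun i => by
        change A i * (Matrix.of (X i) + Matrix.of (Y i)) * B i = _
        rw [mul_add, add_mul]
        rfl
      map_smul' := fun c X => funext fun i => by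
        change A i * (c • Matrix.of (X i)) * B i = _
        rw [mul_smul_comm, smul_mul_assoc]
        rfl }

theorem blockMulLeftRight_apply (A B : Fin n → Matrix (Fin r) (Fin r) ℂ)
    (X : Fin n → Fin r → Fin r → ℂ) (i : Fin n) :
    blockMulLeftRight A B X i = A i * Matrix.of (X i) * B i := rfl

/-- Translations and conjugations are thus restrictions of linear maps, which are their own
derivatives in the chain rule. -/
theorem blockMulLeftRight_blockCoords (g h k : blockDiagonalGL r n) :
    blockMulLeftRight (diagBlock g) (diagBlock k) (blockCoords h) = blockCoords (g * h * k) := by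
  funext i
  change diagBlock g i * diagBlock h i * diagBlock k i = diagBlock (g * h * k) i
  rw [diagBlock_mul, diagBlock_mul]

end Coordinates

/-! ### Conjugation invariant linear forms -/

theorem Matrix.exists_eq_mul_trace_of_conj_invariant {m : Type*} [Fintype m] [DecidableEq m]
    (φ : Matrix m m ℂ →ₗ[ℂ] ℂ) (hφ : ∀ (g : GL m ℂ) (X : Matrix m m ℂ),
      φ ((g : Matrix m m ℂ) * X * ((g⁻¹ : GL m ℂ) : Matrix m m ℂ)) = φ X) :
    ∃ a : ℂ, ∀ X, φ X = a * X.trace := by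
  -- Invariance at `X = Y * g` reads `φ (g * Y) = φ (Y * g)`; for the transvection `g = 1 + Eᵢⱼ` the
  -- terms `φ Y` cancel.
  have hcomm : ∀ (i j : m), i ≠ j → ∀ Y, φ (single i j 1 * Y) = φ (Y * single i j 1) := by
    intro i j hij Y
    let g : GL m ℂ := GeneralLinearGroup.mkOfDetNeZero (transvection i j 1) (by
      rw [det_transvection_of_ne i j hij]; exact one_ne_zero)
    have h := hφ g (Y * g)
    rw [mul_assoc, mul_assoc, Units.mul_inv, mul_one] at h
    change φ ((1 + single i j 1) * Y) = φ (Y * (1 + single i j 1)) at h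
    rwa [add_mul, mul_add, one_mul, mul_one, map_add, map_add, add_right_inj] at h
  have hoff : ∀ i j : m, i ≠ j → φ (single i j 1) = 0 := by
    intro i j hij
    have h := hcomm i j hij (single j j 1)
    rwa [single_mul_single_same, single_mul_single_of_ne _ _ _ _ hij.symm, mul_one, map_zero] at h
  have hdiag : ∀ i j : m, φ (single i i 1) = φ (single j j 1) := by
    intro i j
    by_cases hij : i = j
    · rw [hij]
    have h := hcomm i j hij (single j i 1)
    rwa [single_mul_single_same, single_mul_single_same, mul_one] at h
  have hsum : ∀ X : Matrix m m ℂ, φ X = ∑ i, X i i * φ (single i i 1) := by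
    intro X
    conv_lhs => rw [matrix_eq_sum_single X]
    rw [map_sum]
    refine Finset.sum_congr rfl fun i _ => ?_
    rw [map_sum, Finset.sum_eq_single i]
    · rw [← smul_eq_mul, ← map_smul, smul_single, smul_eq_mul, mul_one]
    · intro j _ hj
      have : single i j (X i j) = X i j • single i j (1 : ℂ) := by
        rw [smul_single, smul_eq_mul, mul_one]
      rw [this, map_smul, hoff i j hj.symm, smul_zero]
    · exact fun h => absurd (Finset.mem_univ i) h
  rcases isEmpty_or_nonempty m with _ | ⟨⟨k⟩⟩
  · exact ⟨0, fun X => by rw [hsum X, zero_mul, Finset.univ_eq_empty, Finset.sum_empty]⟩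
  · refine ⟨φ (single k k 1), fun X => ?_⟩
    rw [hsum X, mul_comm, trace, Finset.sum_mul]
    exact Finset.sum_congr rfl fun i _ => by rw [hdiag i k, diag_apply]

/-- The trace of the `i`-th block. -/
noncomputable def blockTrace {r n : ℕ} (i : Fin n) : (Fin n → Fin r → Fin r → ℂ) →L[ℂ] ℂ :=
  LinearMap.toContinuousLinearMap
    ((Matrix.traceLinearMap (Fin r) ℂ ℂ).comp
      ((Matrix.ofLinearEquiv ℂ).toLinearMap.comp (LinearMap.proj i)))

theorem blockTrace_apply {r n : ℕ} (i : Fin n) (X : Fin n → Fin r → Fin r → ℂ) :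
    blockTrace i X = (Matrix.of (X i)).trace := rfl

theorem exists_eq_sum_blockTrace_of_conj_invariant {r n : ℕ}
    (Λ : (Fin n → Fin r → Fin r → ℂ) →L[ℂ] ℂ)
    (hΛ : ∀ g : blockDiagonalGL r n,
      Λ.comp (blockMulLeftRight (diagBlock g) (diagBlock g⁻¹)) = Λ) :
    ∃ α : Fin n → ℂ, Λ = ∑ i, α i • blockTrace i := by
  let ι (i : Fin n) : Matrix (Fin r) (Fin r) ℂ →ₗ[ℂ] (Fin n → Fin r → Fin r → ℂ) :=
    (LinearMap.single ℂ (fun _ : Fin n => Fin r → Fin r → ℂ) i).comp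
      (Matrix.ofLinearEquiv ℂ).symm.toLinearMap
  have hι : ∀ i X, ι i X = Pi.single i (Matrix.of.symm X) := fun _ _ => rfl
  have key : ∀ i, ∃ a : ℂ, ∀ X, (Λ.toLinearMap.comp (ι i)) X = a * X.trace := by
    intro i
    refine Matrix.exists_eq_mul_trace_of_conj_invariant _ fun g X => ?_
    -- The blocks other than `i` may be arbitrary, since `ι i X` vanishes there.
    obtain ⟨h, hh⟩ := exists_diagBlock_eq fun _ : Fin n => g
    have hinv : ∀ j, diagBlock h⁻¹ j = ((g⁻¹ : GL (Fin r) ℂ) : Matrix (Fin r) (Fin r) ℂ) := by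
      intro j
      have : diagBlock h⁻¹ j * (g : Matrix (Fin r) (Fin r) ℂ) = 1 := by
        rw [← hh j, ← diagBlock_mul, inv_mul_cancel, diagBlock_one]
      exact (Units.inv_eq_of_mul_eq_one_left this).symm
    have := DFunLike.congr_fun (hΛ h) (ι i X)
    refine Eq.trans ?_ this
    refine congrArg Λ (funext fun j => ?_)
    change _ = blockMulLeftRight (diagBlock h) (diagBlock h⁻¹) (ι i X) j
    rw [blockMulLeftRight_apply, hh, hinv, hι, hι]
    by_cases hj : j = i
    · subst hj
      rw [Pi.single_eq_same, Pi.single_eq_same]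
      rfl
    · rw [Pi.single_eq_of_ne hj, Pi.single_eq_of_ne hj]
      change _ = _ * (0 : Matrix (Fin r) (Fin r) ℂ) * _
      rw [mul_zero, zero_mul]
      rfl
  choose α hα using key
  refine ⟨α, ContinuousLinearMap.ext fun X => ?_⟩
  have hX : X = ∑ i, ι i (Matrix.of (X i)) := by
    simp only [hι]
    exact (Finset.univ_sum_single X).symm
  conv_lhs => rw [hX]
  rw [map_sum, sum_apply]
  refine Finset.sum_congr rfl fun i _ => ?_
  exact hα i (Matrix.of (X i))

/-! ### The derivative of the determinants of the blocks -/

section Det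

variable {r n : ℕ}

theorem differentiable_det_of (i : Fin n) :
    Differentiable ℂ fun M : Fin n → Fin r → Fin r → ℂ => (Matrix.of (M i)).det := by
  simp only [Matrix.det_apply, Matrix.of_apply]
  fun_prop

theorem hasFDerivAt_det_of_blockCoords_one (i : Fin n) :
    HasFDerivAt (fun M : Fin n → Fin r → Fin r → ℂ => (Matrix.of (M i)).det)
      (blockTrace i) (blockCoords (1 : blockDiagonalGL r n)) := by
  have hd := (differentiable_det_of (r := r) i (blockCoords (1 : blockDiagonalGL r n))).hasFDerivAt
  convert hd using 1
  ext1 X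
  have hone : Matrix.of (blockCoords (1 : blockDiagonalGL r n) i) = 1 := diagBlock_one i
  -- Differentiability is known, so derivatives along lines suffice: `det (1 + tX) = 1 + t tr X +
  -- O(t²)`.
  have h1 : HasDerivAt
      (fun t : ℂ => (Matrix.of ((blockCoords (1 : blockDiagonalGL r n) + t • X) i)).det)
      (blockTrace i X) 0 := by
    obtain ⟨P, hP⟩ : ∃ P : Polynomial ℂ, ∀ t : ℂ, (1 + t • Matrix.of (X i)).det =
        1 + (Matrix.of (X i)).trace * t + P.eval t * t ^ 2 :=
      ⟨_, fun t => Matrix.det_one_add_smul t (Matrix.of (X i))⟩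
    have hline : ∀ t : ℂ, (Matrix.of ((blockCoords (1 : blockDiagonalGL r n) + t • X) i)).det =
        1 + (Matrix.of (X i)).trace * t + P.eval t * t ^ 2 := by
      intro t
      rw [← hP, ← hone]
      rfl
    simp only [hline]
    have h := (((hasDerivAt_id (0 : ℂ)).const_mul (Matrix.of (X i)).trace).const_add 1).add
      ((P.hasDerivAt 0).mul (hasDerivAt_pow 2 (0 : ℂ)))
    refine h.congr_deriv ?_
    simp [blockTrace_apply]
  have h2 := hd.hasLineDerivAt X
  exact h1.unique h2

theorem hasFDerivAt_log_det_of_blockCoords_one (i : Fin n) :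
    HasFDerivAt (fun M : Fin n → Fin r → Fin r → ℂ => Complex.log (Matrix.of (M i)).det)
      (blockTrace i) (blockCoords (1 : blockDiagonalGL r n)) := by
  have hone : (Matrix.of (blockCoords (1 : blockDiagonalGL r n) i)).det = 1 :=
    (congrArg Matrix.det (diagBlock_one i)).trans Matrix.det_one
  have h := (hasFDerivAt_det_of_blockCoords_one (r := r) i).clog
    (by rw [hone]; exact Complex.one_mem_slitPlane)
  rwa [hone, inv_one, one_smul] at h

end Det

/-! ### Covering groups of the group of block diagonal matrices -/

section Cover

variable {r n : ℕ} {H' : Type*} [Group H'] [TopologicalSpace H'] {p : H' →* blockDiagonalGL r n}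

theorem IsUniversalCoveringGroup.isLocalHomeomorph_blockCoords
    (hp : IsUniversalCoveringGroup p) : IsLocalHomeomorph fun h => blockCoords (p h) :=
  isOpenEmbedding_blockCoords.isLocalHomeomorph.comp hp.isCoveringMap.isLocalHomeomorph

theorem IsLocalHomeomorph.locallyPathConnectedSpace {X Y : Type*} [TopologicalSpace X]
    [TopologicalSpace Y] [LocallyPathConnectedSpace Y] {f : X → Y} (hf : IsLocalHomeomorph f) :
    LocallyPathConnectedSpace X := by
  choose e he _ using hf
  let _ : ChartedSpace Y X :=
    { atlas := Set.range e
      chartAt := e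
      mem_chart_source := he
      chart_mem_atlas := Set.mem_range_self }
  exact ChartedSpace.locallyPathConnectedSpace Y X

theorem IsUniversalCoveringGroup.locallyPathConnectedSpace (hp : IsUniversalCoveringGroup p) :
    LocallyPathConnectedSpace H' :=
  hp.isLocalHomeomorph_blockCoords.locallyPathConnectedSpace

/-- The determinant never vanishes, so it lifts through the covering `exp` of the punctured plane.
-/
theorem IsUniversalCoveringGroup.existsUnique_log_det (hp : IsUniversalCoveringGroup p)
    (i : Fin n) : ∃! F : C(H', ℂ), F 1 = 0 ∧
      Complex.exp ∘ F = fun h => (diagBlock (p h) i).det := by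
  have := hp.simplyConnected
  have := hp.locallyPathConnectedSpace
  exact Complex.isCoveringMapOn_exp.existsUnique_continuousMap_lifts
    ⟨fun h => (diagBlock (p h) i).det,
      ((continuous_diagBlock i).comp hp.isCoveringMap.continuous).matrix_det⟩
    (a₀ := 1) (e₀ := 0)
    (by
      change Complex.exp 0 = (diagBlock (p 1) i).det
      rw [Complex.exp_zero, map_one, diagBlock_one, Matrix.det_one])
    fun h => det_diagBlock_ne_zero (p h) i

theorem IsUniversalCoveringGroup.existsUnique_isLogDet (hp : IsUniversalCoveringGroup p) :
    ∃! L : Fin n → H' → ℂ, IsLogDet p L := by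
  choose F hF hF' using hp.existsUnique_log_det
  refine ⟨fun i => F i, ⟨fun i => (F i).continuous, fun i => (hF i).1,
    fun i h => congrFun (hF i).2 h⟩, fun L hL => funext fun i => ?_⟩
  exact congrArg DFunLike.coe
    (hF' i ⟨L i, hL.continuous i⟩ ⟨hL.map_one i, funext (hL.exp_eq i)⟩)

theorem IsLogDet.map_mul {L : Fin n → H' → ℂ} (hL : IsLogDet p L)
    (hp : IsUniversalCoveringGroup p) (i : Fin n) (x y : H') :
    L i (x * y) = L i x + L i y := by
  have := hp.isTopologicalGroup
  -- Both sides are normalised logarithms of the same determinant, so uniqueness of lifts applies.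
  have h : (⟨fun y => L i (x * y) - L i x, by have := hL.continuous i; fun_prop⟩ : C(H', ℂ)) =
      ⟨L i, hL.continuous i⟩ := by
    refine (hp.existsUnique_log_det i).unique ⟨?_, funext fun y => ?_⟩
      ⟨hL.map_one i, funext (hL.exp_eq i)⟩
    · change L i (x * 1) - L i x = 0
      rw [mul_one, sub_self]
    · change Complex.exp (L i (x * y) - L i x) = _
      rw [Complex.exp_sub, hL.exp_eq, hL.exp_eq, _root_.map_mul, diagBlock_mul, Matrix.det_mul,
        mul_div_cancel_left₀ _ (det_diagBlock_ne_zero _ _)]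
  rw [← sub_eq_iff_eq_add']
  exact DFunLike.congr_fun h y

theorem IsLogDet.eventually_eq_log {L : Fin n → H' → ℂ} (hL : IsLogDet p L) (i : Fin n) :
    ∀ᶠ y in 𝓝 (1 : H'), L i y = Complex.log (Matrix.of (blockCoords (p y) i)).det := by
  have him : Tendsto (fun y => (L i y).im) (𝓝 1) (𝓝 0) := by
    have := (Complex.continuous_im.comp (hL.continuous i)).tendsto 1
    rwa [comp_apply, hL.map_one, Complex.zero_im] at this
  filter_upwards [him.eventually (Ioo_mem_nhds (neg_lt_zero.mpr Real.pi_pos) Real.pi_pos)] with y hy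
  have : (Matrix.of (blockCoords (p y) i)).det = Complex.exp (L i y) := (hL.exp_eq i y).symm
  rw [this, Complex.log_exp hy.1 hy.2.le]

theorem IsUniversalCoveringGroup.eventually_nhds_blockCoords (hp : IsUniversalCoveringGroup p)
    (x : H') (P : (Fin n → Fin r → Fin r → ℂ) → Prop) :
    (∀ᶠ M in 𝓝 (blockCoords (p x)), P M) ↔ ∀ᶠ y in 𝓝 x, P (blockCoords (p y)) := by
  rw [← hp.isLocalHomeomorph_blockCoords.map_nhds_eq x, eventually_map]

/-- A multiplicative function on the covering group whose derivative at `1` vanishes is trivial. -/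
theorem IsUniversalCoveringGroup.eq_one_of_hasFDerivAt_zero (hp : IsUniversalCoveringGroup p)
    (ψ : H' →* ℂ) (G : (Fin n → Fin r → Fin r → ℂ) → ℂ)
    (hG : HasFDerivAt G (0 : (Fin n → Fin r → Fin r → ℂ) →L[ℂ] ℂ) (blockCoords (p 1)))
    (hψ : ∀ᶠ y in 𝓝 (1 : H'), ψ y = G (blockCoords (p y))) (h : H') : ψ h = 1 := by
  have := hp.isTopologicalGroup
  have := hp.simplyConnected
  have hderiv : ∀ᶠ M in 𝓝 (blockCoords (p 1)),
      HasFDerivAt G (0 : (Fin n → Fin r → Fin r → ℂ) →L[ℂ] ℂ) M := by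
    rw [hp.eventually_nhds_blockCoords]
    filter_upwards [eventually_eventually_nhds.mpr hψ] with x hx
    have hS (y : H') : blockMulLeftRight (diagBlock (p x⁻¹)) (diagBlock (p 1))
        (blockCoords (p y)) = blockCoords (p (x⁻¹ * y)) := by
      rw [blockMulLeftRight_blockCoords, ← map_mul, ← map_mul, mul_one]
    have ht : Tendsto (fun y => x⁻¹ * y) (𝓝 x) (𝓝 1) := by
      have : Continuous fun y => x⁻¹ * y := by fun_prop
      simpa using this.tendsto x
    -- This is `ψ y = ψ x * ψ (x⁻¹ * y)`, which carries the zero derivative from `1` to `x`.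
    have heq : G =ᶠ[𝓝 (blockCoords (p x))] fun M =>
        ψ x * G (blockMulLeftRight (diagBlock (p x⁻¹)) (diagBlock (p 1)) M) := by
      refine (hp.eventually_nhds_blockCoords x _).mpr ?_
      filter_upwards [hx, ht.eventually hψ] with y hy hy'
      rw [hS, ← hy', ← hy, ← map_mul, mul_inv_cancel_left]
    have hG' : HasFDerivAt G (0 : (Fin n → Fin r → Fin r → ℂ) →L[ℂ] ℂ)
        (blockMulLeftRight (diagBlock (p x⁻¹)) (diagBlock (p 1)) (blockCoords (p x))) := by
      rw [hS, inv_mul_cancel]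
      exact hG
    have hcomp := hG'.comp (blockCoords (p x))
      (blockMulLeftRight (diagBlock (p x⁻¹)) (diagBlock (p 1))).hasFDerivAt
    refine HasFDerivAt.congr_of_eventuallyEq ?_ heq
    refine (hcomp.const_mul (ψ x)).congr_fderiv ?_
    ext1 X
    exact mul_zero (ψ x)
  have hconst : ∀ᶠ M in 𝓝 (blockCoords (p 1)), G M = G (blockCoords (p 1)) := by
    obtain ⟨ε, hε, hball⟩ := Metric.eventually_nhds_iff_ball.mp hderiv
    filter_upwards [Metric.ball_mem_nhds _ hε] with M hM
    exact Metric.isOpen_ball.is_const_of_fderiv_eq_zero (𝕜 := ℂ)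
      (convex_ball (blockCoords (p 1)) ε).isPreconnected
      (fun x hx => (hball x hx).differentiableAt.differentiableWithinAt)
      (fun x hx => (hball x hx).fderiv) hM (Metric.mem_ball_self hε)
  have hker : (ψ.ker : Set H') ∈ 𝓝 (1 : H') := by
    filter_upwards [hψ, (hp.eventually_nhds_blockCoords 1 _).mp hconst] with y hy hy'
    rw [SetLike.mem_coe, MonoidHom.mem_ker, hy, hy', ← hψ.self_of_nhds, map_one]
  have hopen := Subgroup.isOpen_of_mem_nhds _ hker
  have huniv := IsClopen.eq_univ ⟨ψ.ker.isClosed_of_isOpen hopen, hopen⟩ ⟨1, ψ.ker.one_mem⟩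
  exact MonoidHom.mem_ker.mp (huniv.ge (Set.mem_univ h))

/-- The derivative at `1` of a holomorphic character is invariant under conjugation. -/
theorem IsUniversalCoveringGroup.fderiv_conj_invariant (hp : IsUniversalCoveringGroup p)
    (χ : H' →* ℂˣ) (F : (Fin n → Fin r → Fin r → ℂ) → ℂ)
    (Λ : (Fin n → Fin r → Fin r → ℂ) →L[ℂ] ℂ) (hF : HasFDerivAt F Λ (blockCoords (p 1)))
    (hχ : ∀ᶠ y in 𝓝 (1 : H'), (χ y : ℂ) = F (blockCoords (p y))) (g : blockDiagonalGL r n) :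
    Λ.comp (blockMulLeftRight (diagBlock g) (diagBlock g⁻¹)) = Λ := by
  have := hp.isTopologicalGroup
  -- Conjugation by `g` lifts to conjugation by a preimage `x`, where `χ` can be applied.
  obtain ⟨x, rfl⟩ := hp.surjective g
  have hS (y : H') : blockMulLeftRight (diagBlock (p x)) (diagBlock (p x)⁻¹)
      (blockCoords (p y)) = blockCoords (p (x * y * x⁻¹)) := by
    rw [blockMulLeftRight_blockCoords, map_mul, map_mul, map_inv]
  have ht : Tendsto (fun y => x * y * x⁻¹) (𝓝 1) (𝓝 1) := by
    have : Continuous fun y => x * y * x⁻¹ := by fun_prop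
    simpa using this.tendsto 1
  have heq : F =ᶠ[𝓝 (blockCoords (p 1))] fun M =>
      F (blockMulLeftRight (diagBlock (p x)) (diagBlock (p x)⁻¹) M) := by
    refine (hp.eventually_nhds_blockCoords 1 _).mpr ?_
    filter_upwards [hχ, ht.eventually hχ] with y hy hy'
    rw [hS, ← hy', ← hy, map_mul, map_mul, map_inv, mul_inv_cancel_comm]
  have hF' : HasFDerivAt F Λ
      (blockMulLeftRight (diagBlock (p x)) (diagBlock (p x)⁻¹) (blockCoords (p 1))) := by
    rw [hS, mul_one, mul_inv_cancel]
    exact hF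
  have hcomp := hF'.comp (blockCoords (p 1))
    (blockMulLeftRight (diagBlock (p x)) (diagBlock (p x)⁻¹)).hasFDerivAt
  exact (hcomp.congr_of_eventuallyEq heq).unique hF

end Cover

theorem mainTheorem6 (r n : ℕ) {H' : Type*} [Group H'] [TopologicalSpace H']
    (p : H' →* blockDiagonalGL r n) (hp : IsUniversalCoveringGroup p) :
    (∃! L : Fin n → H' → ℂ, IsLogDet p L) ∧
    ∀ χ : H' →* ℂˣ, IsHolomorphicOnCover p (fun h => (χ h : ℂ)) →
      ∃ α : Fin n → ℂ, ∀ L : Fin n → H' → ℂ, IsLogDet p L →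
        ∀ h : H', (χ h : ℂ) = ∏ i, Complex.exp (α i * L i h) := by
  refine ⟨hp.existsUnique_isLogDet, fun χ hχ => ?_⟩
  obtain ⟨F, hF, hχF⟩ := hχ 1
  have hF' := hF.differentiableAt.hasFDerivAt
  obtain ⟨α, hα⟩ := exists_eq_sum_blockTrace_of_conj_invariant _
    (hp.fderiv_conj_invariant χ F _ hF' hχF)
  refine ⟨α, fun L hL h => ?_⟩
  let ψ : H' →* ℂ :=
    { toFun := fun h => (χ h : ℂ) * Complex.exp (-∑ i, α i * L i h)
      map_one' := by simp [hL.map_one]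
      map_mul' := fun x y => by
        simp only [map_mul, Units.val_mul, hL.map_mul hp, mul_add, Finset.sum_add_distrib, neg_add,
          Complex.exp_add]
        ring }
  have hF1 : F (blockCoords (p 1)) = 1 := by
    rw [← hχF.self_of_nhds]
    exact congrArg Units.val (map_one χ)
  have hG : HasFDerivAt (fun M => F M *
      Complex.exp (-∑ i, α i * Complex.log (Matrix.of (M i)).det))
      (0 : (Fin n → Fin r → Fin r → ℂ) →L[ℂ] ℂ) (blockCoords (p 1)) := by
    have hs : HasFDerivAt (fun M : Fin n → Fin r → Fin r → ℂ =>
        ∑ i, α i * Complex.log (Matrix.of (M i)).det)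
        (∑ i, α i • blockTrace i) (blockCoords (p 1)) := by
      rw [map_one]
      exact HasFDerivAt.fun_sum fun i _ =>
        (hasFDerivAt_log_det_of_blockCoords_one i).const_mul (α i)
    -- Both factors equal `1` at the identity, so their derivatives `Λ` and `-∑ αᵢ tr` add up to
    -- zero.
    refine (hF'.mul hs.neg.cexp).congr_fderiv ?_
    rw [hα, hF1]
    simp
  have hψ := hp.eq_one_of_hasFDerivAt_zero ψ _ hG (by
    filter_upwards [hχF, eventually_all.mpr hL.eventually_eq_log] with y hy hy'
    change (χ y : ℂ) * Complex.exp (-∑ i, α i * L i y) = _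
    rw [hy]
    simp only [hy']) h
  change (χ h : ℂ) * Complex.exp (-∑ i, α i * L i h) = 1 at hψ
  rw [← Complex.exp_sum]
  rwa [Complex.exp_neg, mul_inv_eq_one₀ (Complex.exp_ne_zero _)] at hψ
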